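/- Let $L_1,L_2,L_3>0$ and $\Omega=(0,L_1)\times(0,L_2)\times(0,L_3)$. Let $H$ be the space of all $u\in L^2(\Omega,\mathbb R^3)$ with $\operatorname{div}u=0$ in $\Omega$ and $u\cdot\mathbf n=0$ on $\partial\Omega$ (in the weak sense), let $V=H\cap H^1(\Omega,\mathbb R^3)$, and let $\Pi$ be the orthogonal projection of $L^2(\Omega,\mathbb R^3)$ onto $H$. For suitable $u,v\in V$ let $B(u,v)\in V'$ be defined by $$\langle B(u,v),w\rangle_{V',V}=-\int_\Omega(\langle u\cdot\nabla\rangle w)\cdot v\,\mathrm d\Omega,\qquad w\in V,$$ where $\langle u\cdot\nabla\rangle w=(u\cdot\nabla w_1,u\cdot\nabla w_2,u\cdot\nabla w_3)$. For $u,v$ smooth enough and satisfying the Lions boundary conditions ($u\cdot\mathbf n=0$ and vanishing tangential part of $\operatorname{curl}u$ on $\partial\Omega$), $B(u,v)$ is also given by $\Pi(\langle u\cdot\nabla\rangle v)$. Let $k=(k_1,k_2,k_3)$ be a vector of nonnegative integers, and let $w=(w_1,w_2,w_3)\in\mathbb R^3\setminus\{0\}$ satisfy $\frac{w_1k_1}{L_1}+\frac{w_2k_2}{L_2}+\frac{w_3k_3}{L_3}=0$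 and $w_i=0$ whenever $k_i=0$. Let $Y^k$ be the corresponding eigenfunction of the Stokes operator on $\Omega$ under Lions boundary conditions, $$Y^k(x)=\begin{pmatrix} w_1\sin\left(\frac{k_1\pi x_1}{L_1}\right)\cos\left(\frac{k_2\pi x_2}{L_2}\right)\cos\left(\frac{k_3\pi x_3}{L_3}\right)\\ w_2\cos\left(\frac{k_1\pi x_1}{L_1}\right)\sin\left(\frac{k_2\pi x_2}{L_2}\right)\cos\left(\frac{k_3\pi x_3}{L_3}\right)\\ w_3\cos\left(\frac{k_1\pi x_1}{L_1}\right)\cos\left(\frac{k_2\pi x_2}{L_2}\right)\sin\left(\frac{k_3\pi x_3}{L_3}\right) \end{pmatrix}.$$ Then $Y^k\in V$, and: - if no component of $k$ vanishes, then $B(Y^k,Y^k)\neq0$; - if exactly one component of $k$ vanishes, then $B(Y^k,Y^k)=0$. Both assertions hold for $B(Y^k,Y^k)$ as a functional on $V$ and for $\Pi(\langle Y^k\cdot\nabla\rangle Y^k)$ as an element of $H$. -/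

import Mathlib

open MeasureTheory
open scoped ContDiff

noncomputable section

namespace LionsStokes

/-- Three-dimensional Euclidean space. -/
abbrev E3 : Type := EuclideanSpace ℝ (Fin 3)

/-- The open box `(0, L₁) × (0, L₂) × (0, L₃)`. -/
def box (L : Fin 3 → ℝ) : Set E3 := {x | ∀ i, 0 < x i ∧ x i < L i}

/-- Lebesgue measure on the box. -/
abbrev boxMeasure (L : Fin 3 → ℝ) : Measure E3 := (volume : Measure E3).restrict (box L)

/-- The space `L²(Ω, F)`. -/
abbrev L2 (F : Type) [NormedAddCommGroup F] (L : Fin 3 → ℝ) : Type := Lp F 2 (boxMeasure L)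

theorem exists_isCompact_superset (L : Fin 3 → ℝ) : ∃ K : Set E3, IsCompact K ∧ box L ⊆ K := by
  refine ⟨(PiLp.continuousLinearEquiv 2 ℝ (fun _ : Fin 3 => ℝ)).symm ''
    Set.pi Set.univ (fun i => Set.Icc 0 (L i)),
    (isCompact_univ_pi fun i => isCompact_Icc).image (ContinuousLinearEquiv.continuous _), ?_⟩
  intro x hx
  refine ⟨WithLp.ofLp x, fun i _ => ⟨(hx i).1.le, (hx i).2.le⟩, ?_⟩
  simp

/-- A continuous field on the whole space restricts to a square integrable field on the box. -/
theorem memLp_of_continuous {F : Type} [NormedAddCommGroup F] (L : Fin 3 → ℝ) {f : E3 → F}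
    (hf : Continuous f) : MemLp f 2 (boxMeasure L) := by
  obtain ⟨K, hK, hLK⟩ := exists_isCompact_superset L
  obtain ⟨C, hC⟩ := hK.exists_bound_of_continuousOn hf.continuousOn
  have : IsFiniteMeasure ((volume : Measure E3).restrict K) :=
    isFiniteMeasure_restrict.2 hK.measure_lt_top.ne
  have h : MemLp f 2 ((volume : Measure E3).restrict K) := by
    refine MemLp.of_bound (hf.continuousOn.aestronglyMeasurable_of_isCompact hK hK.measurableSet)
      C ?_
    exact (ae_restrict_iff' hK.measurableSet).2 (Filter.Eventually.of_forall hC)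
  exact h.mono_measure (Measure.restrict_mono hLK le_rfl)

/-- The class in `L²(Ω, F)` of a field that is continuous on the whole space. -/
def toL2 {F : Type} [NormedAddCommGroup F] (L : Fin 3 → ℝ) (f : E3 → F) (hf : Continuous f) :
    L2 F L :=
  (memLp_of_continuous L hf).toLp f

theorem continuous_gradient {φ : E3 → ℝ} (hφ : ContDiff ℝ ∞ φ) :
    Continuous (fun x => gradient φ x) := by
  unfold gradient
  exact (LinearIsometryEquiv.continuous _).comp (hφ.continuous_fderiv (by simp))

theorem integral_fderiv_eq_inner (L : Fin 3 → ℝ) (u : L2 E3 L) {φ : E3 → ℝ}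
    (hφ : ContDiff ℝ ∞ φ) :
    ∫ x in box L, fderiv ℝ φ x (u x)
      = inner ℝ (toL2 L (fun x => gradient φ x) (continuous_gradient hφ)) u := by
  rw [L2.inner_def]
  refine integral_congr_ae ?_
  filter_upwards [(memLp_of_continuous L (continuous_gradient hφ)).coeFn_toLp] with x hx
  simp only [toL2]
  rw [hx]
  simp [gradient]

/-- The space `H = {u ∈ L²(Ω, ℝ³) | div u = 0 in Ω, u · n = 0 on ∂Ω}`. Both conditions are meant
weakly: by Green's formula `∫ u · ∇φ = ∫_{∂Ω} (u · n) φ - ∫ (div u) φ`, they hold together if and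
only if `∫ u · ∇φ = 0` for all functions `φ` that are smooth up to the boundary. -/
def H (L : Fin 3 → ℝ) : Submodule ℝ (L2 E3 L) where
  carrier := {u | ∀ φ : E3 → ℝ, ContDiff ℝ ∞ φ → ∫ x in box L, fderiv ℝ φ x (u x) = 0}
  add_mem' := by
    intro u v hu hv φ hφ
    have h1 := hu φ hφ
    have h2 := hv φ hφ
    rw [integral_fderiv_eq_inner L _ hφ] at h1 h2 ⊢
    rw [inner_add_right, h1, h2, add_zero]
  zero_mem' := by
    intro φ hφ
    rw [integral_fderiv_eq_inner L _ hφ, inner_zero_right]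
  smul_mem' := by
    intro c u hu φ hφ
    have h1 := hu φ hφ
    rw [integral_fderiv_eq_inner L _ hφ] at h1 ⊢
    rw [inner_smul_right, h1, mul_zero]

theorem isClosed_H (L : Fin 3 → ℝ) : IsClosed (H L : Set (L2 E3 L)) := by
  have : (H L : Set (L2 E3 L)) = ⋂ (φ : E3 → ℝ) (hφ : ContDiff ℝ ∞ φ),
      {u | inner ℝ (toL2 L (fun x => gradient φ x) (continuous_gradient hφ)) u = (0 : ℝ)} := by
    ext u
    simp only [Set.mem_iInter, Set.mem_ofPred_eq]
    refine forall_congr' fun φ => forall_congr' fun hφ => ?_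
    rw [integral_fderiv_eq_inner L _ hφ]
  rw [this]
  exact isClosed_iInter fun φ => isClosed_iInter fun hφ =>
    isClosed_eq (continuous_const.inner continuous_id) continuous_const

instance instCompleteSpaceH (L : Fin 3 → ℝ) : CompleteSpace (H L) :=
  (isClosed_H L).completeSpace_coe

/-- The orthogonal projection `Π` of `L²(Ω, ℝ³)` onto `H`. -/
def leray (L : Fin 3 → ℝ) : L2 E3 L →L[ℝ] L2 E3 L := (H L).starProjection

/-- `G` is the weak gradient of `u` on the box: `G x e` is the weak derivative of `u` at `x` in the
direction `e`. -/
def IsWeakGrad (L : Fin 3 → ℝ) (u : L2 E3 L) (G : L2 (E3 →L[ℝ] E3) L) : Prop :=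
  ∀ φ : E3 → ℝ, ContDiff ℝ ∞ φ → HasCompactSupport φ → tsupport φ ⊆ box L → ∀ e : E3,
    ∫ x in box L, (fderiv ℝ φ x e) • u x = - ∫ x in box L, φ x • G x e

/-- The space `V = H¹(Ω, ℝ³) ∩ H`. -/
def V (L : Fin 3 → ℝ) : Set (L2 E3 L) := {u | u ∈ H L ∧ ∃ G, IsWeakGrad L u G}

/-- The weak gradient of an element of `V` (it is unique up to null sets). -/
def weakGrad {L : Fin 3 → ℝ} (u : V L) : L2 (E3 →L[ℝ] E3) L := u.2.2.choose

/-- The bilinear operator `B`: the functional `B(u, v)` on `V` is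
`w ↦ -∫_Ω (⟨u · ∇⟩ w) · v`. -/
def B {L : Fin 3 → ℝ} (u v : V L) : V L → ℝ :=
  fun w => - ∫ x in box L,
    inner ℝ (weakGrad w x ((u : L2 E3 L) x)) ((v : L2 E3 L) x)

/-- The number of vanishing components of `k`. -/
def numZero (k : Fin 3 → ℕ) : ℕ := (Finset.univ.filter fun i => k i = 0).card

/-- The nonzero vectors `z` with `z₁k₁/L₁ + z₂k₂/L₂ + z₃k₃/L₃ = 0`, and `zᵢ = 0` whenever
`kᵢ = 0`. -/
def perpSet (L : Fin 3 → ℝ) (k : Fin 3 → ℕ) : Set (Fin 3 → ℝ) :=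
  {z | z ≠ 0 ∧ z 0 * k 0 / L 0 + z 1 * k 1 / L 1 + z 2 * k 2 / L 2 = 0 ∧ ∀ i, k i = 0 → z i = 0}

/-- The eigenfunction of the Stokes operator with frequency `k` and amplitude `w`. -/
def Y (L : Fin 3 → ℝ) (k : Fin 3 → ℕ) (w : Fin 3 → ℝ) (x : E3) : E3 :=
  !₂[w 0 * Real.sin (k 0 * Real.pi * x 0 / L 0) * Real.cos (k 1 * Real.pi * x 1 / L 1)
        * Real.cos (k 2 * Real.pi * x 2 / L 2),
     w 1 * Real.cos (k 0 * Real.pi * x 0 / L 0) * Real.sin (k 1 * Real.pi * x 1 / L 1)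
        * Real.cos (k 2 * Real.pi * x 2 / L 2),
     w 2 * Real.cos (k 0 * Real.pi * x 0 / L 0) * Real.cos (k 1 * Real.pi * x 1 / L 1)
        * Real.sin (k 2 * Real.pi * x 2 / L 2)]

/-- The field `⟨u · ∇⟩ v`, for a differentiable field `v`. -/
def convect (u v : E3 → E3) (x : E3) : E3 := fderiv ℝ v x (u x)

theorem contDiff_Y (L : Fin 3 → ℝ) (k : Fin 3 → ℕ) (w : Fin 3 → ℝ) : ContDiff ℝ ∞ (Y L k w) := by
  rw [contDiff_piLp]
  intro i
  fin_cases i <;> simp [Y] <;> fun_prop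

theorem continuous_convect {u v : E3 → E3} (hu : Continuous u) (hv : ContDiff ℝ ∞ v) :
    Continuous (convect u v) :=
  (hv.continuous_fderiv (by simp)).clm_apply hu

/-- The class in `L²(Ω, ℝ³)` of the eigenfunction `Y`. -/
def YL2 (L : Fin 3 → ℝ) (k : Fin 3 → ℕ) (w : Fin 3 → ℝ) : L2 E3 L :=
  toL2 L (Y L k w) (contDiff_Y L k w).continuous

/-- The class in `L²(Ω, ℝ³)` of `⟨Y · ∇⟩ Y`. -/
def convectYL2 (L : Fin 3 → ℝ) (k : Fin 3 → ℕ) (w : Fin 3 → ℝ) : L2 E3 L :=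
  toL2 L (convect (Y L k w) (Y L k w))
    (continuous_convect (contDiff_Y L k w).continuous (contDiff_Y L k w))

end LionsStokes

end

noncomputable section

namespace LionsStokes

open Filter Topology

/-! Write `a i = k i * π / L i`. The perpendicularity condition says `∑ w i * a i = 0`, that is,
`Y^k` is divergence free. Its normal component vanishes on every face. For such a smooth field `U`,
integrating by parts gives `⟨B(U,U), u⟩ = ∫ (U·∇)U · u` for every `u ∈ V`
(`IsWeakGrad.neg_integral_inner_eq_inner_convect`). Both assertions thus concern one vector,
`(Y·∇)Y`: whether it is orthogonal to `H`, and whether some element of `V` detects it.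

With `∑ w i * a i = 0`, component `i` of `(Y·∇)Y` becomes `(w i / 4) sin(2 a i x i)` times a
combination of `1`, `cos(2 a j x j)` and `cos(2 a l x l)` (`convect_Y_apply`). If `a l = 0`, this is
the gradient of an explicit function of `x i` and `x j`, hence orthogonal to `H`. If no `a i`
vanishes, pairing with an eigenfunction of frequency `2 k i, 2 k j, 0` leaves a nonzero multiple of
`w l * a l * (w i * z i + w j * z j)` (`inner_convectYL2_YL2`). Taking `z = (a j, -a i)`, this is
nonzero for some choice of the axis `l`, since `w` is nonzero and orthogonal to `a`
(`exists_distinct_not_parallel`).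

The analytic work is that a weak gradient only sees test functions compactly supported in the box,
while the integration by parts needs the products `U i * U j`, which merely vanish on the faces `x i
= 0, L i`. Cutoffs bridge this gap (`IsWeakGrad.integral_fderiv_smul`). -/

/-- The `i`-th vector of the standard basis. -/
abbrev basisVec (i : Fin 3) : E3 := EuclideanSpace.single i (1 : ℝ)

/-! ### Smooth cutoffs exhausting the box -/

/-- A smooth step function that vanishes on `(-∞, 1]` and equals `1` on `[2, ∞)`. -/
def step (t : ℝ) : ℝ := Real.smoothTransition (t - 1)

theorem contDiff_step : ContDiff ℝ ∞ step :=
  Real.smoothTransition.contDiff.comp (contDiff_id.sub contDiff_const)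

theorem step_nonneg (t : ℝ) : 0 ≤ step t := Real.smoothTransition.nonneg _

theorem step_le_one (t : ℝ) : step t ≤ 1 := Real.smoothTransition.le_one _

theorem step_of_le_one {t : ℝ} (h : t ≤ 1) : step t = 0 :=
  Real.smoothTransition.zero_of_nonpos (by linarith)

theorem step_of_two_le {t : ℝ} (h : 2 ≤ t) : step t = 1 :=
  Real.smoothTransition.one_of_one_le (by linarith)

theorem deriv_step_of_lt_one {t : ℝ} (h : t < 1) : deriv step t = 0 := by
  have : step =ᶠ[𝓝 t] fun _ => 0 := by
    filter_upwards [Iio_mem_nhds h] with s hs using step_of_le_one (le_of_lt hs)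
  rw [this.deriv_eq, deriv_const]

theorem deriv_step_of_two_lt {t : ℝ} (h : 2 < t) : deriv step t = 0 := by
  have : step =ᶠ[𝓝 t] fun _ => 1 := by
    filter_upwards [Ioi_mem_nhds h] with s hs using step_of_two_le (le_of_lt hs)
  rw [this.deriv_eq, deriv_const]

/-- The derivative lives on `[1, 2]`, so a compactness bound there suffices. The factor `t` will
absorb the factor `n` produced by differentiating `cutoff L n`. -/
theorem exists_bound_mul_deriv_step : ∃ M, 0 ≤ M ∧ ∀ t, |t * deriv step t| ≤ M := by
  have hc : Continuous fun t => t * deriv step t :=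
    continuous_id.mul (contDiff_step.continuous_deriv (by simp))
  obtain ⟨M, hM⟩ := (isCompact_Icc (a := (1 : ℝ)) (b := 2)).exists_bound_of_continuousOn
    hc.continuousOn
  have h0 : 0 ≤ M := (norm_nonneg _).trans (hM 1 (by norm_num))
  refine ⟨M, h0, fun t => ?_⟩
  by_cases h1 : t < 1
  · simpa [deriv_step_of_lt_one h1] using h0
  by_cases h2 : 2 < t
  · simpa [deriv_step_of_two_lt h2] using h0
  exact hM t ⟨not_lt.1 h1, not_lt.1 h2⟩

/-- A smooth cutoff function supported in the box, which tends to `1` on the box as `n → ∞`. -/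
def cutoff (L : Fin 3 → ℝ) (n : ℕ) (x : E3) : ℝ := ∏ j, step (n * (x j * (L j - x j)))

theorem contDiff_cutoff (L : Fin 3 → ℝ) (n : ℕ) : ContDiff ℝ ∞ (cutoff L n) := by
  unfold cutoff
  refine contDiff_prod fun j _ => contDiff_step.comp ?_
  fun_prop

theorem cutoff_nonneg (L : Fin 3 → ℝ) (n : ℕ) (x : E3) : 0 ≤ cutoff L n x :=
  Finset.prod_nonneg fun _ _ => step_nonneg _

theorem cutoff_le_one (L : Fin 3 → ℝ) (n : ℕ) (x : E3) : cutoff L n x ≤ 1 :=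
  Finset.prod_le_one (fun _ _ => step_nonneg _) fun _ _ => step_le_one _

theorem tsupport_cutoff_subset (L : Fin 3 → ℝ) (hL : ∀ i, 0 < L i) (n : ℕ) :
    tsupport (cutoff L n) ⊆ box L := by
  have hcl : IsClosed {x : E3 | ∀ j, 1 ≤ n * (x j * (L j - x j))} := by
    simp only [Set.ofPred_forall]
    exact isClosed_iInter fun j => isClosed_le continuous_const (by fun_prop)
  refine (closure_minimal (fun x hx => ?_) hcl).trans fun x hx i => ?_
  · intro j
    by_contra h
    exact hx (Finset.prod_eq_zero (Finset.mem_univ j) (step_of_le_one (not_le.1 h).le))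
  · have h1 : 1 ≤ n * (x i * (L i - x i)) := hx i
    have hn : (0 : ℝ) ≤ n := n.cast_nonneg
    have h2 : 0 < x i * (L i - x i) := by
      by_contra h
      nlinarith
    have := hL i
    rcases pos_and_pos_or_neg_and_neg_of_mul_pos h2 with h | h
    · exact ⟨h.1, by linarith [h.2]⟩
    · linarith [h.1, h.2]

theorem hasCompactSupport_cutoff (L : Fin 3 → ℝ) (hL : ∀ i, 0 < L i) (n : ℕ) :
    HasCompactSupport (cutoff L n) := by
  obtain ⟨K, hK, hLK⟩ := exists_isCompact_superset L
  exact hK.of_isClosed_subset (isClosed_tsupport _) ((tsupport_cutoff_subset L hL n).trans hLK)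

theorem isOpen_box (L : Fin 3 → ℝ) : IsOpen (box L) := by
  have : box L = ⋂ i, {x : E3 | 0 < x i} ∩ {x : E3 | x i < L i} := by
    ext x; simp [box]
  rw [this]
  exact isOpen_iInter_of_finite fun i =>
    (isOpen_lt continuous_const (by fun_prop)).inter (isOpen_lt (by fun_prop) continuous_const)

theorem measurableSet_box (L : Fin 3 → ℝ) : MeasurableSet (box L) := (isOpen_box L).measurableSet

instance isFiniteMeasure_boxMeasure (L : Fin 3 → ℝ) : IsFiniteMeasure (boxMeasure L) := by
  obtain ⟨K, hK, hLK⟩ := exists_isCompact_superset L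
  exact isFiniteMeasure_restrict.2 ((measure_mono hLK).trans_lt hK.measure_lt_top).ne

theorem exists_bound_on_box {F : Type} [NormedAddCommGroup F] (L : Fin 3 → ℝ) {f : E3 → F}
    (hf : Continuous f) : ∃ D, ∀ x ∈ box L, ‖f x‖ ≤ D := by
  obtain ⟨K, hK, hLK⟩ := exists_isCompact_superset L
  obtain ⟨D, hD⟩ := hK.exists_bound_of_continuousOn hf.continuousOn
  exact ⟨D, fun x hx => hD x (hLK hx)⟩

/-- Equality on a neighbourhood, not only at `x`, makes the derivatives of the cutoffs converge
pointwise as well. -/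
theorem eventually_cutoff_eventuallyEq_one (L : Fin 3 → ℝ) {x : E3} (hx : x ∈ box L) :
    ∀ᶠ n : ℕ in atTop, cutoff L n =ᶠ[𝓝 x] fun _ => 1 := by
  have h1 : ∀ j, ∀ᶠ n : ℕ in atTop, 2 < n * (x j * (L j - x j)) := fun j =>
    (tendsto_natCast_atTop_atTop.atTop_mul_const
      (mul_pos (hx j).1 (sub_pos.2 (hx j).2))).eventually_gt_atTop 2
  filter_upwards [eventually_all.2 h1] with n hn
  have h2 : ∀ j, ∀ᶠ y : E3 in 𝓝 x, 2 < n * (y j * (L j - y j)) := fun j => by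
    have hc : Continuous fun y : E3 => n * (y j * (L j - y j)) := by fun_prop
    exact hc.continuousAt.eventually_const_lt (hn j)
  filter_upwards [eventually_all.2 h2] with y hy
  exact Finset.prod_eq_one fun j _ => step_of_two_le (hy j).le

theorem fderiv_cutoff_basisVec (L : Fin 3 → ℝ) (n : ℕ) (x : E3) (i : Fin 3) :
    fderiv ℝ (cutoff L n) x (basisVec i) =
      deriv step (n * (x i * (L i - x i))) * (n * (L i - 2 * x i)) *
        ∏ j ∈ Finset.univ.erase i, step (n * (x j * (L j - x j))) := by
  have hd : DifferentiableAt ℝ (cutoff L n) x := (contDiff_cutoff L n).differentiable (by simp) x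
  rw [← hd.lineDeriv_eq_fderiv, lineDeriv]
  have h : (fun t : ℝ => cutoff L n (x + t • basisVec i)) = fun t : ℝ =>
      step (n * ((x i + t) * (L i - (x i + t)))) *
        ∏ j ∈ Finset.univ.erase i, step (n * (x j * (L j - x j))) := by
    funext t
    rw [cutoff, ← Finset.mul_prod_erase _ _ (Finset.mem_univ i)]
    congr 1
    · simp
    · refine Finset.prod_congr rfl fun j hj => ?_
      simp [Finset.ne_of_mem_erase hj]
  rw [h]
  have h0 : HasDerivAt (fun t : ℝ => x i + t) 1 0 := (hasDerivAt_id 0).const_add _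
  have h1 : HasDerivAt (fun t : ℝ => n * ((x i + t) * (L i - (x i + t))))
      (n * (L i - 2 * x i)) 0 := by
    exact ((h0.fun_mul (h0.const_sub (L i))).const_mul (n : ℝ)).congr_deriv (by ring)
  have h2 : HasDerivAt step (deriv step (n * (x i * (L i - x i))))
      (n * ((x i + 0) * (L i - (x i + 0)))) := by
    simpa using (contDiff_step.differentiable (by simp) (n * (x i * (L i - x i)))).hasDerivAt
  exact ((h2.comp 0 h1).mul_const _).deriv

/-- The bound does not depend on `n`: with `t = n * (x i * (L i - x i))` the left side is `|t *
deriv step t|` times factors bounded by `L i` and `1`. A test function decaying like `x i * (L i - x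
i)` therefore controls the blow-up of the cutoff's derivative. -/
theorem abs_fderiv_cutoff_mul_le {M : ℝ} (hM : ∀ t, |t * deriv step t| ≤ M)
    (L : Fin 3 → ℝ) (n : ℕ) {x : E3} (hx : x ∈ box L) (i : Fin 3) :
    |fderiv ℝ (cutoff L n) x (basisVec i)| * (x i * (L i - x i)) ≤ M * L i := by
  have hx1 := (hx i).1
  have hx2 := (hx i).2
  have hq : 0 < x i * (L i - x i) := mul_pos hx1 (by linarith)
  have hL : 0 < L i := by linarith
  set P := ∏ j ∈ Finset.univ.erase i, step (n * (x j * (L j - x j)))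
  have hP0 : 0 ≤ P := Finset.prod_nonneg fun _ _ => step_nonneg _
  have hP1 : P ≤ 1 := Finset.prod_le_one (fun _ _ => step_nonneg _) fun _ _ => step_le_one _
  have hM0 : 0 ≤ M := (abs_nonneg _).trans (hM 0)
  have key : |fderiv ℝ (cutoff L n) x (basisVec i)| * (x i * (L i - x i)) =
      |(n * (x i * (L i - x i))) * deriv step (n * (x i * (L i - x i)))| *
        |L i - 2 * x i| * P := by
    calc _ = |fderiv ℝ (cutoff L n) x (basisVec i) * (x i * (L i - x i))| := by
          rw [abs_mul, abs_of_pos hq]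
      _ = |(n * (x i * (L i - x i))) * deriv step (n * (x i * (L i - x i))) *
            (L i - 2 * x i) * P| := by
          rw [fderiv_cutoff_basisVec]
          congr 1
          ring
      _ = _ := by rw [abs_mul, abs_mul, abs_of_nonneg hP0]
  rw [key]
  have h3 : |L i - 2 * x i| ≤ L i := abs_le.2 ⟨by linarith, by linarith⟩
  calc _ ≤ M * L i * 1 := by
        have := hL.le
        gcongr
        exact hM _
    _ = _ := mul_one _

/-! ### Integration by parts up to the boundary -/

/-- The weak gradient may be tested against smooth functions that need not have compact support
in the box, as long as they vanish on the two faces orthogonal to the direction of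
differentiation. -/
theorem IsWeakGrad.integral_fderiv_smul {L : Fin 3 → ℝ} (hL : ∀ i, 0 < L i) {u : L2 E3 L}
    {G : L2 (E3 →L[ℝ] E3) L} (hG : IsWeakGrad L u G) {ψ : E3 → ℝ} (hψ : ContDiff ℝ ∞ ψ)
    (i : Fin 3) {C : ℝ} (hC : ∀ x ∈ box L, |ψ x| ≤ C * (x i * (L i - x i))) :
    ∫ x in box L, (fderiv ℝ ψ x (basisVec i)) • u x
      = - ∫ x in box L, ψ x • G x (basisVec i) := by
  obtain ⟨M, hM0, hM⟩ := exists_bound_mul_deriv_step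
  have hdψ : Continuous fun x => fderiv ℝ ψ x (basisVec i) :=
    (hψ.continuous_fderiv (by simp)).clm_apply continuous_const
  obtain ⟨D, hD⟩ := exists_bound_on_box L hdψ
  obtain ⟨D', hD'⟩ := exists_bound_on_box L hψ.continuous
  have hu : Integrable (fun x => u x) (boxMeasure L) := (Lp.memLp u).integrable (by norm_num)
  have hGi : Integrable (fun x => G x (basisVec i)) (boxMeasure L) :=
    ((Lp.memLp G).integrable (by norm_num)).apply_continuousLinearMap _
  have hprod : ∀ n, ContDiff ℝ ∞ fun x => cutoff L n x * ψ x := fun n =>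
    (contDiff_cutoff L n).mul hψ
  have htest : ∀ n : ℕ, ∫ x in box L, (fderiv ℝ (fun x => cutoff L n x * ψ x) x (basisVec i)) • u x
      = - ∫ x in box L, (cutoff L n x * ψ x) • G x (basisVec i) := fun n =>
    hG _ (hprod n) ((hasCompactSupport_cutoff L hL n).mul_right)
      ((closure_mono (Function.support_mul_subset_left _ _)).trans
        (tsupport_cutoff_subset L hL n)) _
  have hformula : ∀ (n : ℕ) (x : E3), fderiv ℝ (fun x => cutoff L n x * ψ x) x (basisVec i) =
      cutoff L n x * fderiv ℝ ψ x (basisVec i)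
        + ψ x * fderiv ℝ (cutoff L n) x (basisVec i) := fun n x => by
    rw [fderiv_fun_mul ((contDiff_cutoff L n).differentiable (by simp) x)
      (hψ.differentiable (by simp) x)]
    simp
  -- Dominated convergence: `D` bounds the term in which `ψ` is differentiated, and `|C| * (M * L
  -- i)` the term in which the cutoff is.
  have h1 : Tendsto (fun n : ℕ => ∫ x in box L,
      (fderiv ℝ (fun x => cutoff L n x * ψ x) x (basisVec i)) • u x) atTop
      (𝓝 (∫ x in box L, (fderiv ℝ ψ x (basisVec i)) • u x)) := by
    refine tendsto_integral_of_dominated_convergence (fun x => (D + |C| * (M * L i)) * ‖u x‖)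
      (fun n => ?_) (hu.norm.const_mul _) (fun n => ?_) ?_
    · exact (((hprod n).continuous_fderiv (by simp)).clm_apply
        continuous_const).aestronglyMeasurable.smul hu.aestronglyMeasurable
    · refine (ae_restrict_iff' (measurableSet_box L)).2 (Eventually.of_forall fun x hx => ?_)
      rw [norm_smul]
      gcongr
      rw [hformula]
      have hq : 0 < x i * (L i - x i) := mul_pos (hx i).1 (sub_pos.2 (hx i).2)
      have hψx : |ψ x| ≤ |C| * (x i * (L i - x i)) :=
        (hC x hx).trans (by gcongr; exact le_abs_self C)
      refine (norm_add_le _ _).trans (add_le_add ?_ ?_)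
      · rw [norm_mul, Real.norm_of_nonneg (cutoff_nonneg L n x)]
        exact (mul_le_of_le_one_left (norm_nonneg _) (cutoff_le_one L n x)).trans (hD x hx)
      · rw [norm_mul, Real.norm_eq_abs, Real.norm_eq_abs]
        calc _ ≤ |C| * (x i * (L i - x i)) * |fderiv ℝ (cutoff L n) x (basisVec i)| := by gcongr
          _ = |C| * (|fderiv ℝ (cutoff L n) x (basisVec i)| * (x i * (L i - x i))) := by ring
          _ ≤ _ := by
            exact mul_le_mul_of_nonneg_left (abs_fderiv_cutoff_mul_le hM L n hx i)
              (abs_nonneg C)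
    · refine (ae_restrict_iff' (measurableSet_box L)).2 (Eventually.of_forall fun x hx => ?_)
      refine tendsto_const_nhds.congr' ?_
      filter_upwards [eventually_cutoff_eventuallyEq_one L hx] with n hn
      rw [hformula, hn.fderiv_eq, hn.eq_of_nhds]
      simp
  have h2 : Tendsto (fun n : ℕ => ∫ x in box L, (cutoff L n x * ψ x) • G x (basisVec i)) atTop
      (𝓝 (∫ x in box L, ψ x • G x (basisVec i))) := by
    refine tendsto_integral_of_dominated_convergence (fun x => D' * ‖G x (basisVec i)‖)
      (fun n => ?_) (hGi.norm.const_mul _) (fun n => ?_) ?_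
    · exact (hprod n).continuous.aestronglyMeasurable.smul hGi.aestronglyMeasurable
    · refine (ae_restrict_iff' (measurableSet_box L)).2 (Eventually.of_forall fun x hx => ?_)
      rw [norm_smul, norm_mul, Real.norm_of_nonneg (cutoff_nonneg L n x)]
      gcongr
      exact (mul_le_of_le_one_left (norm_nonneg _) (cutoff_le_one L n x)).trans (hD' x hx)
    · refine (ae_restrict_iff' (measurableSet_box L)).2 (Eventually.of_forall fun x hx => ?_)
      refine tendsto_const_nhds.congr' ?_
      filter_upwards [eventually_cutoff_eventuallyEq_one L hx] with n hn
      rw [hn.eq_of_nhds, one_mul]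
  refine tendsto_nhds_unique h1 ?_
  simp only [htest]
  exact h2.neg

/-- The `i`-th coordinate as a continuous linear map. -/
abbrev coord (i : Fin 3) : E3 →L[ℝ] ℝ := EuclideanSpace.proj i

theorem fderiv_coord {U : E3 → E3} {x : E3} (hU : DifferentiableAt ℝ U x) (i : Fin 3) (e : E3) :
    fderiv ℝ (fun y => U y i) x e = fderiv ℝ U x e i := by
  have : HasFDerivAt (fun y => U y i) ((coord i).comp (fderiv ℝ U x)) x :=
    (coord i).hasFDerivAt.comp x hU.hasFDerivAt
  rw [this.fderiv]
  simp

theorem coeFn_toL2 {F : Type} [NormedAddCommGroup F] (L : Fin 3 → ℝ) {f : E3 → F}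
    (hf : Continuous f) : toL2 L f hf =ᵐ[boxMeasure L] f :=
  (memLp_of_continuous L hf).coeFn_toLp

theorem integrableOn_box_of_continuous {F : Type} [NormedAddCommGroup F] (L : Fin 3 → ℝ)
    {f : E3 → F} (hf : Continuous f) : Integrable f (boxMeasure L) :=
  (memLp_of_continuous L hf).integrable (by norm_num)

/-- The classical derivative of a smooth field is its weak gradient. -/
theorem isWeakGrad_toL2 (L : Fin 3 → ℝ) {f : E3 → E3} (hf : ContDiff ℝ ∞ f) :
    IsWeakGrad L (toL2 L f hf.continuous)
      (toL2 L (fun x => fderiv ℝ f x) (hf.continuous_fderiv (by simp))) := by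
  intro φ hφ hφc hφs e
  have hdφ : Continuous fun x => fderiv ℝ φ x e :=
    (hφ.continuous_fderiv (by simp)).clm_apply continuous_const
  have hdf : Continuous fun x => fderiv ℝ f x e :=
    (hf.continuous_fderiv (by simp)).clm_apply continuous_const
  have hdφc : HasCompactSupport fun x => fderiv ℝ φ x e := hφc.fderiv_apply (𝕜 := ℝ) e
  -- As `φ` is supported in the box, both integrals extend to the whole space, where the classical
  -- integration by parts applies.
  have h1 : ∫ x in box L, (fderiv ℝ φ x e) • toL2 L f hf.continuous x
      = ∫ x, (fderiv ℝ φ x e) • f x := by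
    refine Eq.trans ?_ (setIntegral_eq_integral_of_forall_compl_eq_zero (s := box L) ?_)
    · refine integral_congr_ae ?_
      filter_upwards [coeFn_toL2 L hf.continuous] with x hx
      rw [hx]
    · intro x hx
      have : x ∉ tsupport φ := fun h => hx (hφs h)
      rw [fderiv_of_notMem_tsupport ℝ this]
      simp
  have h2 : ∫ x in box L, φ x • toL2 L (fun x => fderiv ℝ f x)
        (hf.continuous_fderiv (by simp)) x e = ∫ x, φ x • fderiv ℝ f x e := by
    refine Eq.trans ?_ (setIntegral_eq_integral_of_forall_compl_eq_zero (s := box L) ?_)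
    · refine integral_congr_ae ?_
      filter_upwards [coeFn_toL2 L (hf.continuous_fderiv (by simp))] with x hx
      rw [hx]
    · intro x hx
      have : x ∉ tsupport φ := fun h => hx (hφs h)
      rw [image_eq_zero_of_notMem_tsupport this, zero_smul]
  rw [h1, h2, integral_smul_fderiv_eq_neg_fderiv_smul_of_integrable, neg_neg]
  · exact (hdφ.smul hf.continuous).integrable_of_hasCompactSupport hdφc.smul_right
  · exact (hφ.continuous.smul hdf).integrable_of_hasCompactSupport hφc.smul_right
  · exact (hφ.continuous.smul hf.continuous).integrable_of_hasCompactSupport hφc.smul_right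
  · exact fun x _ => hφ.differentiable (by simp) x
  · exact fun x _ => hf.differentiable (by simp) x

theorem IsWeakGrad.integral_fderiv_mul_coord {L : Fin 3 → ℝ} (hL : ∀ i, 0 < L i) {u : L2 E3 L}
    {G : L2 (E3 →L[ℝ] E3) L} (hG : IsWeakGrad L u G) {ψ : E3 → ℝ} (hψ : ContDiff ℝ ∞ ψ)
    (i : Fin 3) {C : ℝ} (hC : ∀ x ∈ box L, |ψ x| ≤ C * (x i * (L i - x i))) (j : Fin 3) :
    ∫ x in box L, fderiv ℝ ψ x (basisVec i) * u x j
      = - ∫ x in box L, ψ x * G x (basisVec i) j := by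
  have hdψ : Continuous fun x => fderiv ℝ ψ x (basisVec i) :=
    (hψ.continuous_fderiv (by simp)).clm_apply continuous_const
  obtain ⟨D, hD⟩ := exists_bound_on_box L hdψ
  obtain ⟨D', hD'⟩ := exists_bound_on_box L hψ.continuous
  have hu : Integrable (fun x => u x) (boxMeasure L) := (Lp.memLp u).integrable (by norm_num)
  have hGi : Integrable (fun x => G x (basisVec i)) (boxMeasure L) :=
    ((Lp.memLp G).integrable (by norm_num)).apply_continuousLinearMap _
  have h1 : Integrable (fun x => (fderiv ℝ ψ x (basisVec i)) • u x) (boxMeasure L) :=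
    hu.bdd_smul D hdψ.aestronglyMeasurable ((ae_restrict_iff' (measurableSet_box L)).2
      (Eventually.of_forall hD))
  have h2 : Integrable (fun x => ψ x • G x (basisVec i)) (boxMeasure L) :=
    hGi.bdd_smul D' hψ.continuous.aestronglyMeasurable ((ae_restrict_iff' (measurableSet_box L)).2
      (Eventually.of_forall hD'))
  have h := congrArg (coord j)
    (hG.integral_fderiv_smul hL hψ i hC)
  rw [map_neg, ← ContinuousLinearMap.integral_comp_comm _ h1,
    ← ContinuousLinearMap.integral_comp_comm _ h2] at h
  simpa using h

theorem integral_fderiv_basisVec_eq_zero {L : Fin 3 → ℝ} (hL : ∀ i, 0 < L i) {ψ : E3 → ℝ}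
    (hψ : ContDiff ℝ ∞ ψ) (i : Fin 3) {C : ℝ}
    (hC : ∀ x ∈ box L, |ψ x| ≤ C * (x i * (L i - x i))) :
    ∫ x in box L, fderiv ℝ ψ x (basisVec i) = 0 := by
  -- A constant field has zero weak gradient, so testing it leaves only the integral of the
  -- derivative of `ψ`.
  have hc : ContDiff ℝ ∞ fun _ : E3 => basisVec 0 := contDiff_const
  have h := (isWeakGrad_toL2 L hc).integral_fderiv_mul_coord hL hψ i hC 0
  have h1 : ∫ x in box L, fderiv ℝ ψ x (basisVec i) * toL2 L _ hc.continuous x 0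
      = ∫ x in box L, fderiv ℝ ψ x (basisVec i) := by
    refine integral_congr_ae ?_
    filter_upwards [coeFn_toL2 L hc.continuous] with x hx
    rw [hx]
    simp
  rw [← h1, h, neg_eq_zero]
  refine integral_eq_zero_of_ae ?_
  filter_upwards [coeFn_toL2 L (hc.continuous_fderiv (by simp))] with x hx
  rw [hx]
  simp

theorem eq_sum_basisVec (v : E3) : v = ∑ i, v i • basisVec i := by
  ext j
  fin_cases j <;> simp [Fin.sum_univ_three]

/-! ### Smooth divergence free fields tangent to the boundary -/

/-- A smooth divergence free field that is tangent to the boundary belongs to `H`. -/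
theorem toL2_mem_H {L : Fin 3 → ℝ} (hL : ∀ i, 0 < L i) {U : E3 → E3} (hU : ContDiff ℝ ∞ U)
    (hdiv : ∀ x, ∑ i, fderiv ℝ U x (basisVec i) i = 0)
    (hbd : ∀ i, ∃ C, ∀ x ∈ box L, |U x i| ≤ C * (x i * (L i - x i))) :
    toL2 L U hU.continuous ∈ H L := by
  intro φ hφ
  have hUi : ∀ i, ContDiff ℝ ∞ fun x => U x i := (contDiff_piLp 2).1 hU
  have hφU : ∀ i, ContDiff ℝ ∞ fun x => φ x * U x i := fun i => hφ.mul (hUi i)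
  have hcoord : ∀ i x e, fderiv ℝ (fun y => U y i) x e = fderiv ℝ U x e i := fun i x e =>
    fderiv_coord (hU.differentiable (by simp) x) i e
  have hz : ∀ i, ∫ x in box L, fderiv ℝ (fun y => φ y * U y i) x (basisVec i) = 0 := fun i => by
    obtain ⟨C, hC⟩ := hbd i
    obtain ⟨D, hD⟩ := exists_bound_on_box L hφ.continuous
    refine integral_fderiv_basisVec_eq_zero hL (hφU i) i (C := D * C) fun x hx => ?_
    rw [abs_mul, mul_assoc]
    exact mul_le_mul (hD x hx) (hC x hx) (abs_nonneg _) ((norm_nonneg _).trans (hD x hx))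
  have hint : ∀ i, Integrable (fun x => fderiv ℝ (fun y => φ y * U y i) x (basisVec i))
      (boxMeasure L) := fun i => integrableOn_box_of_continuous L
    (((hφU i).continuous_fderiv (by simp)).clm_apply continuous_const)
  -- Since `div U = 0`, `∇φ · U = ∑ i, ∂ᵢ(φ * U i)`, and each summand integrates to zero because `U
  -- i` vanishes on the faces orthogonal to direction `i`.
  calc _ = ∫ x in box L, ∑ i, fderiv ℝ (fun y => φ y * U y i) x (basisVec i) := by
        refine integral_congr_ae ?_
        filter_upwards [coeFn_toL2 L hU.continuous] with x hx
        rw [hx]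
        have : ∀ i, fderiv ℝ (fun y => φ y * U y i) x (basisVec i)
            = φ x * fderiv ℝ U x (basisVec i) i + U x i * fderiv ℝ φ x (basisVec i) := fun i => by
          rw [fderiv_fun_mul (hφ.differentiable (by simp) x) ((hUi i).differentiable (by simp) x),
            ← hcoord]
          simp
        simp only [this, Finset.sum_add_distrib, ← Finset.mul_sum, hdiv, mul_zero, zero_add]
        conv_lhs => rw [eq_sum_basisVec (U x)]
        simp
    _ = 0 := by
        rw [integral_finsetSum _ fun i _ => hint i]
        simp [hz]

theorem toL2_mem_V {L : Fin 3 → ℝ} (hL : ∀ i, 0 < L i) {U : E3 → E3} (hU : ContDiff ℝ ∞ U)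
    (hdiv : ∀ x, ∑ i, fderiv ℝ U x (basisVec i) i = 0)
    (hbd : ∀ i, ∃ C, ∀ x ∈ box L, |U x i| ≤ C * (x i * (L i - x i))) :
    toL2 L U hU.continuous ∈ V L :=
  ⟨toL2_mem_H hL hU hdiv hbd, _, isWeakGrad_toL2 L hU⟩

/-- For a smooth divergence free field tangent to the boundary, the weak and the strong form of the
convection term agree. -/
theorem IsWeakGrad.neg_integral_inner_eq_inner_convect {L : Fin 3 → ℝ} (hL : ∀ i, 0 < L i)
    {U : E3 → E3} (hU : ContDiff ℝ ∞ U)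
    (hdiv : ∀ x, ∑ i, fderiv ℝ U x (basisVec i) i = 0)
    (hbd : ∀ i, ∃ C, ∀ x ∈ box L, |U x i| ≤ C * (x i * (L i - x i)))
    {u : L2 E3 L} {G : L2 (E3 →L[ℝ] E3) L} (hG : IsWeakGrad L u G) :
    - ∫ x in box L, inner ℝ (G x (toL2 L U hU.continuous x)) (toL2 L U hU.continuous x)
      = inner ℝ (toL2 L (convect U U) (continuous_convect hU.continuous hU)) u := by
  have hUi : ∀ i, ContDiff ℝ ∞ fun x => U x i := (contDiff_piLp 2).1 hU
  have hUU : ∀ i j, ContDiff ℝ ∞ fun x => U x i * U x j := fun i j => (hUi i).mul (hUi j)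
  have hcoord : ∀ i x e, fderiv ℝ (fun y => U y i) x e = fderiv ℝ U x e i := fun i x e =>
    fderiv_coord (hU.differentiable (by simp) x) i e
  -- The product `U i * U j` inherits the decay of `U i` at the faces orthogonal to direction `i`;
  -- nothing is needed of `U j` beyond boundedness.
  have hstep : ∀ i j, ∫ x in box L, fderiv ℝ (fun y => U y i * U y j) x (basisVec i) * u x j
      = - ∫ x in box L, (U x i * U x j) * G x (basisVec i) j := fun i j => by
    obtain ⟨C, hC⟩ := hbd i
    obtain ⟨D, hD⟩ := exists_bound_on_box L (hUi j).continuous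
    refine hG.integral_fderiv_mul_coord hL (hUU i j) i (C := D * C) (fun x hx => ?_) j
    rw [mul_comm (U x i), abs_mul, mul_assoc]
    exact mul_le_mul (hD x hx) (hC x hx) (abs_nonneg _) ((norm_nonneg _).trans (hD x hx))
  have hu : ∀ j, Integrable (fun x => u x j) (boxMeasure L) := fun j =>
    (coord j).integrable_comp
      ((Lp.memLp u).integrable (by norm_num))
  have hGi : ∀ i j, Integrable (fun x => G x (basisVec i) j) (boxMeasure L) := fun i j =>
    (coord j).integrable_comp
      (((Lp.memLp G).integrable (by norm_num)).apply_continuousLinearMap _)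
  have hbdd : ∀ {f g : E3 → ℝ}, Continuous f → Integrable g (boxMeasure L) →
      Integrable (fun x => f x * g x) (boxMeasure L) := fun {f g} hf hg => by
    obtain ⟨D, hD⟩ := exists_bound_on_box L hf
    exact hg.bdd_smul D hf.aestronglyMeasurable ((ae_restrict_iff' (measurableSet_box L)).2
      (Eventually.of_forall hD))
  have hint1 : ∀ i j, Integrable (fun x => fderiv ℝ (fun y => U y i * U y j) x (basisVec i) * u x j)
      (boxMeasure L) := fun i j =>
    hbdd (((hUU i j).continuous_fderiv (by simp)).clm_apply continuous_const) (hu j)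
  have hint2 : ∀ i j, Integrable (fun x => (U x i * U x j) * G x (basisVec i) j)
      (boxMeasure L) := fun i j => hbdd (hUU i j).continuous (hGi i j)
  have hlhs : ∫ x in box L, inner ℝ (G x (toL2 L U hU.continuous x)) (toL2 L U hU.continuous x)
      = ∑ i, ∑ j, ∫ x in box L, (U x i * U x j) * G x (basisVec i) j := by
    simp_rw [← integral_finsetSum _ fun j _ => hint2 _ j]
    rw [← integral_finsetSum _ fun i _ => integrable_finsetSum _ fun j _ => hint2 i j]
    refine integral_congr_ae ?_
    filter_upwards [coeFn_toL2 L hU.continuous] with x hx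
    rw [hx]
    have : G x (U x) = ∑ i, U x i • G x (basisVec i) := by
      conv_lhs => rw [eq_sum_basisVec (U x)]
      simp
    rw [this, sum_inner]
    refine Finset.sum_congr rfl fun i _ => ?_
    rw [inner_smul_left, PiLp.inner_apply, Finset.mul_sum]
    refine Finset.sum_congr rfl fun j _ => ?_
    simp
    ring
  have hrhs : inner ℝ (toL2 L (convect U U) (continuous_convect hU.continuous hU)) u
      = ∑ i, ∑ j, ∫ x in box L, fderiv ℝ (fun y => U y i * U y j) x (basisVec i) * u x j := by
    simp_rw [← integral_finsetSum _ fun j _ => hint1 _ j]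
    rw [← integral_finsetSum _ fun i _ => integrable_finsetSum _ fun j _ => hint1 i j,
      L2.inner_def]
    refine integral_congr_ae ?_
    filter_upwards [coeFn_toL2 L (continuous_convect hU.continuous hU)] with x hx
    rw [hx, PiLp.inner_apply, Finset.sum_comm]
    refine Finset.sum_congr rfl fun j _ => ?_
    -- Summed over `i`, the second term is `U j * div U = 0`, which leaves component `j` of
    -- `(U·∇)U`.
    have : ∀ i, fderiv ℝ (fun y => U y i * U y j) x (basisVec i)
        = U x i * fderiv ℝ U x (basisVec i) j + U x j * fderiv ℝ U x (basisVec i) i := fun i => by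
      rw [fderiv_fun_mul ((hUi i).differentiable (by simp) x) ((hUi j).differentiable (by simp) x),
        ← hcoord, ← hcoord]
      simp
    rw [← Finset.sum_mul]
    simp only [this, Finset.sum_add_distrib, ← Finset.mul_sum, hdiv, mul_zero, add_zero]
    have hconv : convect U U x = ∑ i, U x i • fderiv ℝ U x (basisVec i) := by
      rw [convect]
      conv_lhs => rw [eq_sum_basisVec (U x)]
      simp
    rw [hconv]
    simp [mul_comm]
  rw [hlhs, hrhs]
  simp only [hstep, Finset.sum_neg_distrib]

/-! ### The eigenfunctions and their convection term -/

/-- The angular frequency `kᵢ π / Lᵢ`. -/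
def freq (L : Fin 3 → ℝ) (k : Fin 3 → ℕ) (i : Fin 3) : ℝ := k i * Real.pi / L i

theorem sum_eq_of_distinct {i j l : Fin 3} (hij : i ≠ j) (hil : i ≠ l) (hjl : j ≠ l)
    (f : Fin 3 → ℝ) : ∑ t, f t = f i + f j + f l := by
  have : (Finset.univ : Finset (Fin 3)) = {i, j, l} := by
    revert i j l; decide
  rw [this, Finset.sum_insert (by simp [hij, hil]), Finset.sum_insert (by simp [hjl]),
    Finset.sum_singleton, add_assoc]

theorem prod_eq_of_distinct {i j l : Fin 3} (hij : i ≠ j) (hil : i ≠ l) (hjl : j ≠ l)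
    (f : Fin 3 → ℝ) : ∏ t, f t = f i * f j * f l := by
  have : (Finset.univ : Finset (Fin 3)) = {i, j, l} := by
    revert i j l; decide
  rw [this, Finset.prod_insert (by simp [hij, hil]), Finset.prod_insert (by simp [hjl]),
    Finset.prod_singleton, mul_assoc]

theorem exists_distinct (l : Fin 3) : ∃ i j : Fin 3, i ≠ j ∧ i ≠ l ∧ j ≠ l := by
  revert l; decide

/-- Indexing by an arbitrary distinct triple lets one formula serve all three components and every
choice of distinguished axis. -/
theorem Y_apply (L : Fin 3 → ℝ) (k : Fin 3 → ℕ) (w : Fin 3 → ℝ) (x : E3) {i j l : Fin 3}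
    (hij : i ≠ j) (hil : i ≠ l) (hjl : j ≠ l) :
    Y L k w x i = w i * Real.sin (freq L k i * x i) *
      (Real.cos (freq L k j * x j) * Real.cos (freq L k l * x l)) := by
  simp only [freq, ← mul_div_right_comm]
  fin_cases i <;> fin_cases j <;> simp at hij <;> fin_cases l <;> simp at hil hjl <;>
    simp [Y] <;> ring

theorem fderiv_Y_apply (L : Fin 3 → ℝ) (k : Fin 3 → ℕ) (w : Fin 3 → ℝ) (x v : E3) {i j l : Fin 3}
    (hij : i ≠ j) (hil : i ≠ l) (hjl : j ≠ l) :
    fderiv ℝ (Y L k w) x v i = w i *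
      (freq L k i * Real.cos (freq L k i * x i) *
          Real.cos (freq L k j * x j) * Real.cos (freq L k l * x l) * v i
        - freq L k j * Real.sin (freq L k i * x i) *
          Real.sin (freq L k j * x j) * Real.cos (freq L k l * x l) * v j
        - freq L k l * Real.sin (freq L k i * x i) *
          Real.cos (freq L k j * x j) * Real.sin (freq L k l * x l) * v l) := by
  rw [← fderiv_coord ((contDiff_Y L k w).differentiable (by simp) x)]
  simp only [Y_apply L k w _ hij hil hjl]
  have h : ∀ t, HasFDerivAt (fun y : E3 => freq L k t * y t) (freq L k t • coord t) x := fun t =>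
    (coord t).hasFDerivAt.const_mul _
  rw [(((h i).sin.const_mul (w i)).fun_mul ((h j).cos.fun_mul (h l).cos)).fderiv]
  simp
  ring

theorem sum_fderiv_Y {L : Fin 3 → ℝ} {k : Fin 3 → ℕ} {w : Fin 3 → ℝ}
    (h : ∑ i, w i * freq L k i = 0) (x : E3) :
    ∑ i, fderiv ℝ (Y L k w) x (basisVec i) i = 0 := by
  rw [Fin.sum_univ_three] at h ⊢
  rw [fderiv_Y_apply L k w x _ (i := 0) (j := 1) (l := 2) (by decide) (by decide) (by decide),
    fderiv_Y_apply L k w x _ (i := 1) (j := 0) (l := 2) (by decide) (by decide) (by decide),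
    fderiv_Y_apply L k w x _ (i := 2) (j := 0) (l := 1) (by decide) (by decide) (by decide)]
  simp
  linear_combination (Real.cos (freq L k 0 * x 0) * Real.cos (freq L k 1 * x 1) *
    Real.cos (freq L k 2 * x 2)) * h

/-- The sine is bounded by the frequency times the distance to either face, the far one because
`freq L k i * L i` is a multiple of `π`. Weighting these two bounds by `L i - x i` and `x i` and
adding gives the product bound. -/
theorem abs_sin_freq_mul_le {L : Fin 3 → ℝ} (k : Fin 3 → ℕ) {x : E3}
    (hx : x ∈ box L) (i : Fin 3) :
    |Real.sin (freq L k i * x i)| ≤ 2 * freq L k i / L i * (x i * (L i - x i)) := by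
  have h1 := (hx i).1
  have h2 := (hx i).2
  have hL : 0 < L i := h1.trans h2
  have ha : 0 ≤ freq L k i := by unfold freq; positivity
  have b1 : |Real.sin (freq L k i * x i)| ≤ freq L k i * x i :=
    (Real.abs_sin_le_abs).trans_eq (abs_of_nonneg (by positivity))
  have b2 : |Real.sin (freq L k i * x i)| ≤ freq L k i * (L i - x i) := by
    have h3 : freq L k i * x i = k i * Real.pi - freq L k i * (L i - x i) := by
      unfold freq; field_simp; ring
    rw [h3, Real.sin_nat_mul_pi_sub, abs_neg, abs_mul, abs_pow, abs_neg, abs_one, one_pow, one_mul]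
    exact Real.abs_sin_le_abs.trans_eq (abs_of_nonneg (mul_nonneg ha (by linarith)))
  rw [div_mul_eq_mul_div, le_div_iff₀ hL]
  nlinarith [mul_le_mul_of_nonneg_right b1 (sub_nonneg.2 h2.le),
    mul_le_mul_of_nonneg_right b2 h1.le]

theorem exists_abs_Y_le (L : Fin 3 → ℝ) (k : Fin 3 → ℕ) (w : Fin 3 → ℝ) (i : Fin 3) :
    ∃ C, ∀ x ∈ box L, |Y L k w x i| ≤ C * (x i * (L i - x i)) := by
  obtain ⟨j, l, hjl, hji, hli⟩ := exists_distinct i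
  refine ⟨|w i| * (2 * freq L k i / L i), fun x hx => ?_⟩
  rw [Y_apply L k w x hji.symm hli.symm hjl, abs_mul, abs_mul, abs_mul]
  have hb := abs_sin_freq_mul_le k hx i
  have h1 := Real.abs_cos_le_one (freq L k j * x j)
  have h2 := Real.abs_cos_le_one (freq L k l * x l)
  calc _ ≤ |w i| * |Real.sin (freq L k i * x i)| * 1 := by
        exact mul_le_mul_of_nonneg_left (mul_le_one₀ h1 (abs_nonneg _) h2) (by positivity)
    _ ≤ _ := by
        rw [mul_one, mul_assoc]
        exact mul_le_mul_of_nonneg_left hb (abs_nonneg _)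

theorem YL2_mem_V {L : Fin 3 → ℝ} (hL : ∀ i, 0 < L i) {k : Fin 3 → ℕ} {w : Fin 3 → ℝ}
    (h : ∑ i, w i * freq L k i = 0) : YL2 L k w ∈ V L :=
  toL2_mem_V hL (contDiff_Y L k w) (sum_fderiv_Y h) (exists_abs_Y_le L k w)

/-- The identity holds for every weak gradient of `u`, so the one selected by choice inside `B` does
not matter. -/
theorem B_YL2_apply {L : Fin 3 → ℝ} (hL : ∀ i, 0 < L i) {k : Fin 3 → ℕ} {w : Fin 3 → ℝ}
    (h : ∑ i, w i * freq L k i = 0) (hY : YL2 L k w ∈ V L) (u : V L) :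
    B ⟨YL2 L k w, hY⟩ ⟨YL2 L k w, hY⟩ u = inner ℝ (convectYL2 L k w) (u : L2 E3 L) :=
  IsWeakGrad.neg_integral_inner_eq_inner_convect hL (contDiff_Y L k w) (sum_fderiv_Y h)
    (exists_abs_Y_le L k w) u.2.2.choose_spec

/-- Replacing squared sines by `1 - cos²` produces `∑ w i * a i` times `cos² cos²`, which vanishes.
The double-angle formulas and `-(w j * a j + w l * a l) = w i * a i` then give this form. -/
theorem convect_Y_apply {L : Fin 3 → ℝ} {k : Fin 3 → ℕ} {w : Fin 3 → ℝ}
    (h : ∑ i, w i * freq L k i = 0) (x : E3) {i j l : Fin 3}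
    (hij : i ≠ j) (hil : i ≠ l) (hjl : j ≠ l) :
    convect (Y L k w) (Y L k w) x i = w i / 4 * Real.sin (2 * freq L k i * x i) *
      (w i * freq L k i - w l * freq L k l * Real.cos (2 * freq L k j * x j)
        - w j * freq L k j * Real.cos (2 * freq L k l * x l)) := by
  rw [sum_eq_of_distinct hij hil hjl] at h
  rw [convect, fderiv_Y_apply L k w x _ hij hil hjl, Y_apply L k w x hij hil hjl,
    Y_apply L k w x hij.symm hjl hil, Y_apply L k w x hil.symm hjl.symm hij]
  simp only [mul_assoc (2 : ℝ), Real.sin_two_mul, Real.cos_two_mul]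
  have hj := Real.sin_sq_add_cos_sq (freq L k j * x j)
  have hl := Real.sin_sq_add_cos_sq (freq L k l * x l)
  generalize Real.sin (freq L k i * x i) = si at *
  generalize Real.cos (freq L k i * x i) = ci at *
  generalize Real.sin (freq L k j * x j) = sj at *
  generalize Real.cos (freq L k j * x j) = cj at *
  generalize Real.sin (freq L k l * x l) = sl at *
  generalize Real.cos (freq L k l * x l) = cl at *
  linear_combination w i * si * ci * (cj ^ 2 * cl ^ 2 - 1 / 2) * h
    - w i * si * ci * (w j * freq L k j) * cl ^ 2 * hj
    - w i * si * ci * (w l * freq L k l) * cj ^ 2 * hl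

/-! ### A vanishing frequency: the convection term is a gradient -/

/-- If one frequency vanishes, the convection term of the eigenfunction is a gradient, hence
orthogonal to `H`. -/
theorem inner_convectYL2_eq_zero {L : Fin 3 → ℝ} {k : Fin 3 → ℕ} {w : Fin 3 → ℝ}
    (h : ∑ i, w i * freq L k i = 0) {l : Fin 3} (hk : k l = 0) {u : L2 E3 L} (hu : u ∈ H L) :
    inner ℝ (convectYL2 L k w) u = 0 := by
  obtain ⟨i, j, hij, hil, hjl⟩ := exists_distinct l
  have ha : freq L k l = 0 := by simp [freq, hk]
  -- With `a l = 0` and `w j * a j = -(w i * a i)`, component `i` reduces to `(w i ^ 2 * a i / 2)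
  -- sin(2 a i x i)`, likewise for `j`, and component `l` is zero; `φ` is an antiderivative.
  set φ : E3 → ℝ := fun x => -(1 / 4) * (w i ^ 2 * Real.cos (2 * freq L k i * x i)
    + w j ^ 2 * Real.cos (2 * freq L k j * x j)) with hφdef
  have hφ : ContDiff ℝ ∞ φ := by fun_prop
  rw [← hu φ hφ, L2.inner_def]
  refine integral_congr_ae ?_
  filter_upwards [coeFn_toL2 L (continuous_convect (contDiff_Y L k w).continuous
    (contDiff_Y L k w))] with x hx
  rw [convectYL2, hx, PiLp.inner_apply, sum_eq_of_distinct hij hil hjl]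
  have hd : ∀ t, HasFDerivAt (fun y : E3 => 2 * freq L k t * y t) ((2 * freq L k t) • coord t) x :=
    fun t => (coord t).hasFDerivAt.const_mul _
  have hfd : HasFDerivAt φ _ x :=
    (((hd i).cos.const_mul (w i ^ 2)).fun_add ((hd j).cos.const_mul (w j ^ 2))).const_mul (-(1 / 4))
  rw [hfd.fderiv, convect_Y_apply h x hij hil hjl, convect_Y_apply h x hij.symm hjl hil,
    convect_Y_apply h x hil.symm hjl.symm hij]
  rw [sum_eq_of_distinct hij hil hjl, ha, mul_zero, add_zero] at h
  simp [ha]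
  linear_combination (-(1 / 4) * w i * Real.sin (2 * freq L k i * x i) * u x i
    - 1 / 4 * w j * Real.sin (2 * freq L k j * x j) * u x j) * h

/-! ### Nonvanishing frequencies: a detecting eigenfunction -/

theorem setIntegral_box_prod {L : Fin 3 → ℝ} (hL : ∀ i, 0 < L i) (f : Fin 3 → ℝ → ℝ) :
    ∫ x in box L, ∏ t, f t (x t) = ∏ t, ∫ s in (0 : ℝ)..(L t), f t s := by
  have hbox : box L = (WithLp.ofLp : E3 → Fin 3 → ℝ) ⁻¹'
      (Set.univ.pi fun t => Set.Ioo 0 (L t)) := by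
    ext x; simp [box]
  rw [hbox, (PiLp.volume_preserving_ofLp (Fin 3)).setIntegral_preimage_emb
    (MeasurableEquiv.toLp 2 (Fin 3 → ℝ)).symm.measurableEmbedding
    (fun y : Fin 3 → ℝ => ∏ t, f t (y t)), volume_pi, Measure.restrict_pi_pi,
    integral_fintype_prod_eq_prod]
  refine Finset.prod_congr rfl fun t _ => ?_
  rw [intervalIntegral.integral_of_le (hL t).le, integral_Ioc_eq_integral_Ioo]

theorem setIntegral_box_mul {L : Fin 3 → ℝ} (hL : ∀ i, 0 < L i) {i j l : Fin 3}
    (hij : i ≠ j) (hil : i ≠ l) (hjl : j ≠ l) (f g h : ℝ → ℝ) :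
    ∫ x in box L, f (x i) * g (x j) * h (x l) =
      (∫ s in (0 : ℝ)..(L i), f s) * (∫ s in (0 : ℝ)..(L j), g s) *
        ∫ s in (0 : ℝ)..(L l), h s := by
  have := setIntegral_box_prod hL fun t => if t = i then f else if t = j then g else h
  simp only [prod_eq_of_distinct hij hil hjl] at this
  simpa [hij.symm, hil.symm, hjl.symm] using this

/-- Doubled frequencies fit whole periods into each edge, so the boundary terms in the integrals
below vanish. -/
theorem two_mul_freq_mul {L : Fin 3 → ℝ} (hL : ∀ i, 0 < L i) (k : Fin 3 → ℕ) (i : Fin 3) :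
    2 * freq L k i * L i = (2 * k i : ℕ) * Real.pi := by
  have := (hL i).ne'
  unfold freq; push_cast; field_simp

theorem integral_cos_two_freq {L : Fin 3 → ℝ} (hL : ∀ i, 0 < L i) {k : Fin 3 → ℕ} {i : Fin 3}
    (ha : freq L k i ≠ 0) : ∫ s in (0 : ℝ)..(L i), Real.cos (2 * freq L k i * s) = 0 := by
  rw [intervalIntegral.integral_comp_mul_left (fun s => Real.cos s) (by simpa using ha),
    two_mul_freq_mul hL, integral_cos, Real.sin_nat_mul_pi]
  simp

theorem integral_sin_sq_two_freq {L : Fin 3 → ℝ} (hL : ∀ i, 0 < L i) {k : Fin 3 → ℕ} {i : Fin 3}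
    (ha : freq L k i ≠ 0) :
    ∫ s in (0 : ℝ)..(L i), Real.sin (2 * freq L k i * s) ^ 2 = L i / 2 := by
  rw [intervalIntegral.integral_comp_mul_left (fun s => Real.sin s ^ 2) (by simpa using ha),
    two_mul_freq_mul hL, integral_sin_sq, Real.sin_nat_mul_pi, ← two_mul_freq_mul hL]
  simp
  field_simp

theorem integral_cos_sq_two_freq {L : Fin 3 → ℝ} (hL : ∀ i, 0 < L i) {k : Fin 3 → ℕ} {i : Fin 3}
    (ha : freq L k i ≠ 0) :
    ∫ s in (0 : ℝ)..(L i), Real.cos (2 * freq L k i * s) ^ 2 = L i / 2 := by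
  rw [intervalIntegral.integral_comp_mul_left (fun s => Real.cos s ^ 2) (by simpa using ha),
    two_mul_freq_mul hL, integral_cos_sq, Real.sin_nat_mul_pi, ← two_mul_freq_mul hL]
  simp
  field_simp

/-- The pairing of the convection term of an eigenfunction with an eigenfunction of frequency
`2kᵢ, 2kⱼ` in two coordinate directions and `0` in the third. -/
theorem inner_convectYL2_YL2 {L : Fin 3 → ℝ} (hL : ∀ i, 0 < L i) {k m : Fin 3 → ℕ}
    {w z : Fin 3 → ℝ} (h : ∑ i, w i * freq L k i = 0) {i j l : Fin 3}
    (hij : i ≠ j) (hil : i ≠ l) (hjl : j ≠ l) (hk : ∀ t, freq L k t ≠ 0)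
    (hmi : freq L m i = 2 * freq L k i) (hmj : freq L m j = 2 * freq L k j)
    (hml : freq L m l = 0) :
    inner ℝ (convectYL2 L k w) (YL2 L m z) =
      -(1 / 16) * (w l * freq L k l) * (w i * z i + w j * z j) * (L i * L j * L l) := by
  -- Of the six terms, only the two with coefficient `w l * a l` survive: each of the others
  -- contains an unsquared `cos(2 a i x i)` or `cos(2 a j x j)`, of mean zero. Each survivor
  -- integrates to `(L i / 2) * (L j / 2) * L l` times its coefficient.
  have hptwise : inner ℝ (convectYL2 L k w) (YL2 L m z) = ∫ x in box L,
      (w i * z i / 4 * (w i * freq L k i) * (Real.sin (2 * freq L k i * x i) ^ 2 *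
          Real.cos (2 * freq L k j * x j) * 1)
        + -(w i * z i / 4 * (w l * freq L k l)) * (Real.sin (2 * freq L k i * x i) ^ 2 *
          Real.cos (2 * freq L k j * x j) ^ 2 * 1)
        + -(w i * z i / 4 * (w j * freq L k j)) * (Real.sin (2 * freq L k i * x i) ^ 2 *
          Real.cos (2 * freq L k j * x j) * Real.cos (2 * freq L k l * x l))
        + w j * z j / 4 * (w j * freq L k j) * (Real.cos (2 * freq L k i * x i) *
          Real.sin (2 * freq L k j * x j) ^ 2 * 1)
        + -(w j * z j / 4 * (w l * freq L k l)) * (Real.cos (2 * freq L k i * x i) ^ 2 *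
          Real.sin (2 * freq L k j * x j) ^ 2 * 1)
        + -(w j * z j / 4 * (w i * freq L k i)) * (Real.cos (2 * freq L k i * x i) *
          Real.sin (2 * freq L k j * x j) ^ 2 * Real.cos (2 * freq L k l * x l))) := by
    rw [L2.inner_def]
    refine integral_congr_ae ?_
    filter_upwards [coeFn_toL2 L (continuous_convect (contDiff_Y L k w).continuous
      (contDiff_Y L k w)), coeFn_toL2 L (contDiff_Y L m z).continuous] with x hx hx'
    rw [convectYL2, YL2, hx, hx', PiLp.inner_apply, sum_eq_of_distinct hij hil hjl,
      convect_Y_apply h x hij hil hjl, convect_Y_apply h x hij.symm hjl hil,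
      Y_apply L m z x hij hil hjl, Y_apply L m z x hij.symm hjl hil,
      Y_apply L m z x hil.symm hjl.symm hij, hmi, hmj, hml]
    simp
    ring
  rw [hptwise]
  have I : ∀ {f : E3 → ℝ}, Continuous f → Integrable f (boxMeasure L) := fun hf =>
    integrableOn_box_of_continuous L hf
  rw [integral_add (I (by fun_prop)) (I (by fun_prop)),
    integral_add (I (by fun_prop)) (I (by fun_prop)),
    integral_add (I (by fun_prop)) (I (by fun_prop)),
    integral_add (I (by fun_prop)) (I (by fun_prop)),
    integral_add (I (by fun_prop)) (I (by fun_prop))]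
  simp only [integral_const_mul]
  have P := fun f g h => setIntegral_box_mul hL hij hil hjl f g h
  rw [P (fun s => Real.sin (2 * freq L k i * s) ^ 2) (fun s => Real.cos (2 * freq L k j * s))
      (fun _ => 1),
    P (fun s => Real.sin (2 * freq L k i * s) ^ 2) (fun s => Real.cos (2 * freq L k j * s) ^ 2)
      (fun _ => 1),
    P (fun s => Real.sin (2 * freq L k i * s) ^ 2) (fun s => Real.cos (2 * freq L k j * s))
      (fun s => Real.cos (2 * freq L k l * s)),
    P (fun s => Real.cos (2 * freq L k i * s)) (fun s => Real.sin (2 * freq L k j * s) ^ 2)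
      (fun _ => 1),
    P (fun s => Real.cos (2 * freq L k i * s) ^ 2) (fun s => Real.sin (2 * freq L k j * s) ^ 2)
      (fun _ => 1),
    P (fun s => Real.cos (2 * freq L k i * s)) (fun s => Real.sin (2 * freq L k j * s) ^ 2)
      (fun s => Real.cos (2 * freq L k l * s)),
    integral_cos_two_freq hL (hk i), integral_cos_two_freq hL (hk j),
    integral_cos_two_freq hL (hk l), integral_sin_sq_two_freq hL (hk i),
    integral_sin_sq_two_freq hL (hk j), integral_cos_sq_two_freq hL (hk i),
    integral_cos_sq_two_freq hL (hk j)]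
  simp
  ring

/-- Otherwise, every `w l ≠ 0` makes the other two entries of `w` proportional to those of `a`. If
all entries of `w` are nonzero, then `w` is parallel to `a` as well as orthogonal to it, so it is
zero; if some entry vanishes, the proportionality and `h` kill the rest. -/
theorem exists_distinct_not_parallel {w a : Fin 3 → ℝ} (hw : w ≠ 0) (ha : ∀ i, a i ≠ 0)
    (h : ∑ i, w i * a i = 0) : ∃ i j l : Fin 3, i ≠ j ∧ i ≠ l ∧ j ≠ l ∧ w l ≠ 0 ∧
      w i * a j - w j * a i ≠ 0 := by
  by_contra! hcon
  have h2 := hcon 0 1 2 (by decide) (by decide) (by decide)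
  have h1 := hcon 0 2 1 (by decide) (by decide) (by decide)
  have h0 := hcon 1 2 0 (by decide) (by decide) (by decide)
  rw [Fin.sum_univ_three] at h
  have ha0 := ha 0
  have ha1 := ha 1
  have ha2 := ha 2
  have hz : w 0 = 0 ∧ w 1 = 0 ∧ w 2 = 0 := by
    by_cases hw0 : w 0 = 0
    · by_cases hw1 : w 1 = 0
      · simp_all
      · have := h1 hw1
        simp_all
    · have h12 := h0 hw0
      by_cases hw1 : w 1 = 0
      · simp_all
      · by_cases hw2 : w 2 = 0
        · simp_all
        · have e1 := h1 hw1
          have e2 := h2 hw2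
          have : w 0 * (a 0 ^ 2 + a 1 ^ 2 + a 2 ^ 2) = 0 := by
            linear_combination a 0 * h + a 1 * e2 + a 2 * e1
          have hpos : a 0 ^ 2 + a 1 ^ 2 + a 2 ^ 2 ≠ 0 := by positivity
          exact absurd ((mul_eq_zero.1 this).resolve_right hpos) hw0
  refine hw (funext fun t => ?_)
  fin_cases t
  exacts [hz.1, hz.2.1, hz.2.2]

/-- If no frequency vanishes, the convection term of the eigenfunction is not orthogonal to `V`. -/
theorem exists_inner_convectYL2_ne_zero {L : Fin 3 → ℝ} (hL : ∀ i, 0 < L i) {k : Fin 3 → ℕ}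
    {w : Fin 3 → ℝ} (hw : w ≠ 0) (h : ∑ i, w i * freq L k i = 0) (hk : ∀ i, k i ≠ 0) :
    ∃ u ∈ V L, inner ℝ (convectYL2 L k w) u ≠ 0 := by
  have ha : ∀ i, freq L k i ≠ 0 := fun i =>
    div_ne_zero (mul_ne_zero (Nat.cast_ne_zero.2 (hk i)) Real.pi_ne_zero) (hL i).ne'
  obtain ⟨i, j, l, hij, hil, hjl, hwl, hpar⟩ := exists_distinct_not_parallel hw ha h
  -- Doubling `k` in directions `i, j` matches the harmonics of the convection term. The amplitude
  -- `z` is `a` turned by a right angle in that plane: this makes the field divergence free and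
  -- turns the pairing into `w i * a j - w j * a i`, up to nonzero factors.
  let m : Fin 3 → ℕ := fun t => if t = l then 0 else 2 * k t
  let z : Fin 3 → ℝ := fun t => if t = i then freq L k j else if t = j then -freq L k i else 0
  have hzi : z i = freq L k j := by simp [z]
  have hzj : z j = -freq L k i := by simp [z, hij.symm]
  have hmi : freq L m i = 2 * freq L k i := by simp [freq, m, hil]; ring
  have hmj : freq L m j = 2 * freq L k j := by simp [freq, m, hjl]; ring
  have hml : freq L m l = 0 := by simp [freq, m]
  have hz : ∑ t, z t * freq L m t = 0 := by
    rw [sum_eq_of_distinct hij hil hjl, hzi, hzj, hmi, hmj, hml]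
    ring
  refine ⟨YL2 L m z, YL2_mem_V hL hz, ?_⟩
  rw [inner_convectYL2_YL2 hL h hij hil hjl ha hmi hmj hml, hzi, hzj]
  have hpar' : w i * freq L k j + w j * -freq L k i ≠ 0 := by
    simpa [sub_eq_add_neg] using hpar
  have := hL i
  have := hL j
  have := hL l
  have := ha l
  positivity

end LionsStokes

end

/-! ### Conclusion for the functional and for the projection -/

theorem theoremT (L : Fin 3 → ℝ) (hL : ∀ i, 0 < L i) (k : Fin 3 → ℕ) (w : Fin 3 → ℝ)
    (hw : w ∈ LionsStokes.perpSet L k) :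
    ∃ hY : LionsStokes.YL2 L k w ∈ LionsStokes.V L,
      (LionsStokes.numZero k = 0 →
        LionsStokes.B ⟨LionsStokes.YL2 L k w, hY⟩ ⟨LionsStokes.YL2 L k w, hY⟩ ≠ 0 ∧
        LionsStokes.leray L (LionsStokes.convectYL2 L k w) ≠ 0) ∧
      (LionsStokes.numZero k = 1 →
        LionsStokes.B ⟨LionsStokes.YL2 L k w, hY⟩ ⟨LionsStokes.YL2 L k w, hY⟩ = 0 ∧
        LionsStokes.leray L (LionsStokes.convectYL2 L k w) = 0) := by
  obtain ⟨hw0, hperp, -⟩ := hw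
  have h : ∑ i, w i * LionsStokes.freq L k i = 0 := by
    rw [Fin.sum_univ_three]
    simp only [LionsStokes.freq]
    linear_combination Real.pi * hperp
  have hY := LionsStokes.YL2_mem_V hL h
  refine ⟨hY, fun hk => ?_, fun hk => ?_⟩
  · have hk' : ∀ i, k i ≠ 0 := by
      simpa [LionsStokes.numZero, Finset.filter_eq_empty_iff] using hk
    obtain ⟨u, hu, hne⟩ := LionsStokes.exists_inner_convectYL2_ne_zero hL hw0 h hk'
    refine ⟨fun hB => hne ?_, fun hP => hne ?_⟩
    · rw [← LionsStokes.B_YL2_apply hL h hY ⟨u, hu⟩, hB]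
      rfl
    -- The kernel of the projection is the orthogonal complement of `H`, and the detecting field `u`
    -- lies in `H`.
    · exact Submodule.inner_left_of_mem_orthogonal hu.1
        ((Submodule.starProjection_apply_eq_zero_iff _).1 hP)
  · have hpos : 0 < LionsStokes.numZero k := by omega
    obtain ⟨l, hl⟩ := Finset.card_pos.1 hpos
    have hl' : k l = 0 := by simpa using hl
    refine ⟨funext fun u => ?_, ?_⟩
    · rw [LionsStokes.B_YL2_apply hL h hY u]
      exact LionsStokes.inner_convectYL2_eq_zero h hl' u.2.1
    · refine (Submodule.starProjection_apply_eq_zero_iff _).2 ?_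
      exact (Submodule.mem_orthogonal' _ _).2 fun u hu =>
        LionsStokes.inner_convectYL2_eq_zero h hl' hu
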